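/- Let $I$ be a finite set of players with strategies $x_i\in\mathbb{R}$. Let $\kappa_i>0$ for $i\in I$, $K=\mathrm{diag}(\kappa)$, $Z\in\mathbb{R}^{I\times I}$ with $Z_{ii}=0$ for all $i$, and $\xi\in\mathbb{R}^I$. Write $\mathbb 1$ for the identity matrix and assume that $\mathbb 1-KZ$ is invertible, with inverse $L$. Without payments player $i$ has cost $\ell_i(x)=\tfrac12x_i^2-\kappa_i x_i\sum_{j}Z_{ij}x_j$; under an incentive vector $p\in\mathbb{R}^I$ it has total cost $c_i(x,p)=\ell_i(x)+p_ix_i$. The planner's cost is $\Phi(x)=\tfrac12\sum_i(x_i+\xi_i)^2$, and the externality is $e_i(x)=\partial_{x_i}\Phi(x)-\partial_{x_i}\ell_i(x)$, that is, $e(x)=\xi+KZx$. (1) $\Phi$ has the unique minimizer $x^\dagger=-\xi$, and for every $p$ the unique Nash equilibrium is $x^*(p)=-(\mathbb 1-KZ)^{-1}p$. The unique socially optimal incentive vector (the unique $p$ for which $x^*(p)$ minimizes $\Phi$) is $p^\dagger=(\mathbb 1-KZ)\xi$. It is also the unique $p$ with $e(x^*(p))=p$. (2) All eigenvalues of $\mathbb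 1-KZ$ have positive real part if and only if all eigenvalues of $L$ do. In that case let $\gamma_k,\beta_k\in(0,1)$ be any step sizes with $\sum_k\gamma_k=\sum_k\beta_k=\infty$, $\sum_k(\gamma_k^2+\beta_k^2)<\infty$ and $\beta_k/\gamma_k\to0$. Then, from every initial pair of vectors, the two-timescale dynamics $$x_{k+1}=(1-\gamma_k)x_k+\gamma_k\,BR(x_k,p_k),\qquad p_{k+1}=(1-\beta_k)p_k+\beta_k\,e(x_k),$$ where $BR_i(x,p)=\arg\min_{y\in\mathbb{R}}c_i(y,x_{-i},p)$ is the best response of player $i$, that is, $BR(x,p)=KZx-p$, satisfy $\lim_{k\to\infty}(x_k,p_k)=(x^\dagger,p^\dagger)$. -/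

import Mathlib

open Filter Topology

noncomputable section

namespace QuadGame

variable {ι : Type*} [Fintype ι] [DecidableEq ι]

/-- The neighbourhood aggregate `a_i(x) = ∑ j, Z i j * x j`. -/
def aggregate (Z : Matrix ι ι ℝ) (i : ι) (x : ι → ℝ) : ℝ := ∑ j, Z i j * x j

/-- The cost `ℓ_i(x) = x_i ^ 2 / 2 - κ_i x_i a_i(x)` of player `i` without payments. -/
def loss (κ : ι → ℝ) (Z : Matrix ι ι ℝ) (i : ι) (x : ι → ℝ) : ℝ :=
  (1 / 2) * x i ^ 2 - κ i * x i * aggregate Z i x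

/-- The total cost `c_i(x, p) = ℓ_i(x) + p_i x_i` of player `i` under the incentive vector `p`. -/
def totalCost (κ : ι → ℝ) (Z : Matrix ι ι ℝ) (p : ι → ℝ) (i : ι) (x : ι → ℝ) : ℝ :=
  loss κ Z i x + p i * x i

/-- `x` is a Nash equilibrium under the incentive vector `p` (each strategy set is `ℝ`). -/
def IsNash (κ : ι → ℝ) (Z : Matrix ι ι ℝ) (p x : ι → ℝ) : Prop :=
  ∀ i, ∀ t : ℝ, totalCost κ Z p i x ≤ totalCost κ Z p i (Function.update x i t)

/-- The quadratic cost of the social planner. -/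
def socialCost (ξ : ι → ℝ) (x : ι → ℝ) : ℝ := (1 / 2) * ∑ i, (x i + ξ i) ^ 2

/-- `x` minimizes the social cost. -/
def IsSociallyOptimal (ξ : ι → ℝ) (x : ι → ℝ) : Prop :=
  ∀ y : ι → ℝ, socialCost ξ x ≤ socialCost ξ y

/-- Partial derivative of `f` at `x` with respect to the coordinate `i`. -/
def partialDeriv (i : ι) (f : (ι → ℝ) → ℝ) (x : ι → ℝ) : ℝ :=
  deriv (fun t : ℝ => f (Function.update x i t)) (x i)

/-- The externality: marginal social cost minus the marginal cost of the player. -/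
def externality (κ : ι → ℝ) (Z : Matrix ι ι ℝ) (ξ : ι → ℝ) (x : ι → ℝ) : ι → ℝ :=
  fun i => partialDeriv i (socialCost ξ) x - partialDeriv i (loss κ Z i) x

/-- The incentive vector `p` is socially optimal: the game with incentives `p` has an equilibrium,
and every equilibrium is a socially optimal strategy profile. -/
def IsSociallyOptimalIncentive (κ : ι → ℝ) (Z : Matrix ι ι ℝ) (ξ : ι → ℝ) (p : ι → ℝ) : Prop :=
  (∃ x, IsNash κ Z p x) ∧ ∀ x, IsNash κ Z p x → IsSociallyOptimal ξ x

/-- `y` is a profile of best responses: `y i` minimizes the total cost of player `i` against the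
strategies `x j` of the others, `j ≠ i`. -/
def IsBestResponse (κ : ι → ℝ) (Z : Matrix ι ι ℝ) (x p y : ι → ℝ) : Prop :=
  ∀ i, ∀ t : ℝ, totalCost κ Z p i (Function.update x i (y i)) ≤
    totalCost κ Z p i (Function.update x i t)

/-- The joint dynamics of strategies (best response, step sizes `γ`) and of incentives
(externality, step sizes `β`). -/
def IsLearningDynamics (κ : ι → ℝ) (Z : Matrix ι ι ℝ) (ξ : ι → ℝ) (γ β : ℕ → ℝ)
    (x p : ℕ → ι → ℝ) : Prop :=
  ∀ k, (∃ y, IsBestResponse κ Z (x k) (p k) y ∧ x (k + 1) = (1 - γ k) • x k + γ k • y) ∧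
    p (k + 1) = (1 - β k) • p k + β k • externality κ Z ξ (x k)

/-- Two-timescale step sizes: `γ` for the strategies, `β` for the incentives. -/
structure IsStepSizes (γ β : ℕ → ℝ) : Prop where
  mem_x : ∀ k, γ k ∈ Set.Ioo (0 : ℝ) 1
  mem_p : ∀ k, β k ∈ Set.Ioo (0 : ℝ) 1
  sum_x : Tendsto (fun n => ∑ k ∈ Finset.range n, γ k) atTop atTop
  sum_p : Tendsto (fun n => ∑ k ∈ Finset.range n, β k) atTop atTop
  sq_summable : Summable fun k => γ k ^ 2 + β k ^ 2
  ratio : Tendsto (fun k => β k / γ k) atTop (𝓝 0)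

/-- The matrix `I - K Z` with `K = diag(κ)`; its inverse is the Leontief matrix. -/
def networkMatrix (κ : ι → ℝ) (Z : Matrix ι ι ℝ) : Matrix ι ι ℝ := 1 - Matrix.diagonal κ * Z

/-- The complex spectrum of a real square matrix, that is, its set of complex eigenvalues. -/
def spec (A : Matrix ι ι ℝ) : Set ℂ := spectrum ℂ (A.map Complex.ofReal)

end QuadGame

end

/-!
The costs are quadratic in a player's own strategy and `Z i i = 0`, so best responses and equilibria
are given by linear first-order conditions (`isBestResponse_iff`, `isNash_iff`), and the statements
on optimal incentives are linear algebra with `M = 1 - K Z`. The spectral condition passes to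
`L = M⁻¹` because `z ↦ z⁻¹` preserves the right half-plane.

For the dynamics, put `u = x + ξ` and `q = p - M ξ`. Then
`u' = u - γ (M u + q)` and `q' = q + β (u - M u - q)`. With `v = u + L q`, the deviation of `u` from
the equilibrium induced by `q`, this reads
`v' = v - γ M v + β L ((1 - M) v - L q)` and `q' = q - β L q + β (1 - M) v`.
The spectrum of `M` is compact in the right half-plane, so `1 - ε M` has spectral radius below one
for some `ε > 0`, and Gelfand's formula gives an equivalent norm that `1 - ε M` contracts. By
convexity, `1 - γ M` contracts it by `1 - c γ` for all `γ ≤ ε` (`exists_seminorm_sub_smul_le`); the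
same holds for `L`. Writing `a`, `b` for these norms of `v` and `q`, one gets
`a' ≤ (1 - c γ) a + β (A a + B b)` and `b' ≤ (1 - d β) b + D β a`. As `β / γ → 0`, the sum `b + s a`
for a small `s > 0` contracts by `1 - (d / 2) β`, and `∑ β = ∞` forces it to zero
(`tendsto_zero_of_two_timescale`).
-/

/-! ### Recursive inequalities -/

lemma tendsto_zero_of_le_one_sub_mul {W β : ℕ → ℝ} {c : ℝ} (hc : 0 < c) (hW : ∀ k, 0 ≤ W k)
    (hβ : Tendsto (fun n => ∑ k ∈ Finset.range n, β k) atTop atTop)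
    (h : ∀ᶠ k in atTop, W (k + 1) ≤ (1 - c * β k) * W k) : Tendsto W atTop (𝓝 0) := by
  set S : ℕ → ℝ := fun n => ∑ k ∈ Finset.range n, β k with hS
  obtain ⟨m, hm⟩ := eventually_atTop.1 h
  have hmono : ∀ n, m ≤ n → W n * Real.exp (c * S n) ≤ W m * Real.exp (c * S m) := by
    intro n hn
    induction n, hn using Nat.le_induction with
    | base => exact le_rfl
    | succ n hn ih =>
      refine le_trans ?_ ih
      have h1 : W (n + 1) ≤ Real.exp (-(c * β n)) * W n :=
        (hm n hn).trans (mul_le_mul_of_nonneg_right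
          (by linarith [Real.add_one_le_exp (-(c * β n))]) (hW n))
      calc W (n + 1) * Real.exp (c * S (n + 1))
          ≤ Real.exp (-(c * β n)) * W n * Real.exp (c * S (n + 1)) := by gcongr
        _ = W n * (Real.exp (-(c * β n)) * Real.exp (c * S (n + 1))) := by ring
        _ = W n * Real.exp (c * S n) := by
          rw [← Real.exp_add, hS]
          simp only [Finset.sum_range_succ]
          ring_nf
  have hlim : Tendsto (fun n => W m * Real.exp (c * S m) * Real.exp (-(c * S n))) atTop (𝓝 0) := by
    simpa using (Real.tendsto_exp_neg_atTop_nhds_zero.comp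
      (hβ.const_mul_atTop hc)).const_mul (W m * Real.exp (c * S m))
  refine squeeze_zero' (Eventually.of_forall hW) ?_ hlim
  filter_upwards [eventually_ge_atTop m] with n hn
  rw [Real.exp_neg, ← div_eq_mul_inv, le_div_iff₀ (Real.exp_pos _)]
  exact hmono n hn

/-- The combination `b + s * a`, with `s` so small that the feedback of `b` into `a` costs at most
half of the decay of `b`, contracts by `1 - (d / 2) * β k` as soon as `β k / γ k` is small. -/
lemma tendsto_zero_of_two_timescale {a b γ β : ℕ → ℝ} {c d A B D : ℝ}
    (hc : 0 < c) (hd : 0 < d) (hB : 0 ≤ B) (ha : ∀ k, 0 ≤ a k) (hb : ∀ k, 0 ≤ b k)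
    (hγ : ∀ k, 0 < γ k) (hβ : ∀ k, 0 < β k)
    (hsum : Tendsto (fun n => ∑ k ∈ Finset.range n, β k) atTop atTop)
    (hratio : Tendsto (fun k => β k / γ k) atTop (𝓝 0))
    (hfast : ∀ᶠ k in atTop, a (k + 1) ≤ (1 - c * γ k) * a k + β k * (A * a k + B * b k))
    (hslow : ∀ᶠ k in atTop, b (k + 1) ≤ (1 - d * β k) * b k + β k * (D * a k)) :
    Tendsto a atTop (𝓝 0) ∧ Tendsto b atTop (𝓝 0) := by
  obtain ⟨s, hs, hsB⟩ : ∃ s : ℝ, 0 < s ∧ s * B ≤ d / 2 := by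
    refine ⟨d / 2 / (B + 1), by positivity, ?_⟩
    rw [div_mul_eq_mul_div, div_le_iff₀ (by positivity)]
    nlinarith
  have hev : ∀ᶠ k in atTop, β k * (A + D / s + d / 2) ≤ c * γ k := by
    have h := hratio.mul_const (A + D / s + d / 2)
    rw [zero_mul] at h
    filter_upwards [h.eventually_le_const hc] with k hk
    rwa [div_mul_eq_mul_div, div_le_iff₀ (hγ k)] at hk
  have hW : Tendsto (fun k => b k + s * a k) atTop (𝓝 0) := by
    refine tendsto_zero_of_le_one_sub_mul (half_pos hd)
      (fun k => add_nonneg (hb k) (mul_nonneg hs.le (ha k))) hsum ?_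
    filter_upwards [hfast, hslow, hev] with k h1 h2 h3
    have h4 : s * a (k + 1) ≤ s * ((1 - c * γ k) * a k + β k * (A * a k + B * b k)) :=
      mul_le_mul_of_nonneg_left h1 hs.le
    have h5 : (s * a k) * (β k * (A + D / s + d / 2)) ≤ (s * a k) * (c * γ k) :=
      mul_le_mul_of_nonneg_left h3 (mul_nonneg hs.le (ha k))
    have h6 : (s * a k) * (β k * (A + D / s + d / 2))
        = β k * a k * (s * A + D + s * (d / 2)) := by
      field_simp
    have h7 : (s * B) * (β k * b k) ≤ d / 2 * (β k * b k) :=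
      mul_le_mul_of_nonneg_right hsB (mul_nonneg (hβ k).le (hb k))
    rw [h6] at h5
    linarith
  constructor
  · have h := hW.const_mul s⁻¹
    rw [mul_zero] at h
    refine squeeze_zero ha (fun k => ?_) h
    rw [mul_add, inv_mul_cancel_left₀ hs.ne']
    exact le_add_of_nonneg_left (mul_nonneg (inv_nonneg.2 hs.le) (hb k))
  · exact squeeze_zero hb (fun k => le_add_of_nonneg_right (mul_nonneg hs.le (ha k))) hW

/-! ### A norm contracted by small explicit Euler steps -/

lemma exists_spectralRadius_one_sub_smul_lt_one {A : Type*} [NormedRing A] [NormedAlgebra ℂ A]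
    [CompleteSpace A] (a : A) (ha : ∀ z ∈ spectrum ℂ a, 0 < z.re) :
    ∃ ε : ℝ, 0 < ε ∧ spectralRadius ℂ (1 - (ε : ℂ) • a) < 1 := by
  have hcpt := spectrum.isCompact (𝕜 := ℂ) a
  obtain ⟨δ, hδ, hre⟩ := hcpt.exists_forall_le' Complex.continuous_re.continuousOn ha
  obtain ⟨R, hR, hnorm⟩ := hcpt.isBounded.exists_pos_norm_le
  refine ⟨δ / R ^ 2, by positivity, ?_⟩
  set ε := δ / R ^ 2 with hε
  have hε0 : 0 < ε := by positivity
  have hεR : ε * R ^ 2 = δ := by rw [hε]; field_simp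
  have hmem : ∀ z ∈ spectrum ℂ (1 - (ε : ℂ) • a), ‖z‖₊ < 1 := by
    intro z hz
    have h1 : (1 : A) - (ε : ℂ) • a = algebraMap ℂ A 1 - Units.mk0 (ε : ℂ) (by
        exact_mod_cast hε0.ne') • a := by
      rw [map_one]; rfl
    rw [h1, ← spectrum.singleton_sub_eq, spectrum.unit_smul_eq_smul] at hz
    obtain ⟨_, rfl, _, ⟨w, hw, rfl⟩, rfl⟩ := hz
    have hw1 := hre w hw
    have hw2 := hnorm w hw
    have hsq : ‖w‖ ^ 2 ≤ R ^ 2 := by gcongr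
    rw [← NNReal.coe_lt_coe, coe_nnnorm, NNReal.coe_one, ← sq_lt_one_iff₀ (norm_nonneg _)]
    rw [Complex.sq_norm, Complex.normSq_apply] at hsq ⊢
    simp at hw1 hsq ⊢
    nlinarith [mul_pos hε0 hδ, mul_le_mul_of_nonneg_left hsq (sq_nonneg ε)]
  rcases (spectrum ℂ (1 - (ε : ℂ) • a)).eq_empty_or_nonempty with h | h
  · rw [spectralRadius, h]
    simp
  · exact_mod_cast spectrum.spectralRadius_lt_of_forall_lt_of_nonempty h hmem

section

variable {E : Type*} [NormedAddCommGroup E] [NormedSpace ℂ E]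

/-- The contracted norm is `∑ k < m, ρ⁻ᵏ ‖Tᵏ v‖`, where `‖Tᵐ‖ ≤ ρᵐ` by Gelfand's formula. -/
lemma exists_seminorm_le_mul_of_spectralRadius_lt_one [CompleteSpace E] (T : E →L[ℂ] E)
    (hT : spectralRadius ℂ T < 1) :
    ∃ (N : Seminorm ℂ E) (C ρ : ℝ), 0 ≤ C ∧ ρ < 1 ∧ (∀ v, ‖v‖ ≤ N v) ∧ (∀ v, N v ≤ C * ‖v‖) ∧
      ∀ v, N (T v) ≤ ρ * N v := by
  obtain ⟨r, hr, hr1⟩ := ENNReal.lt_iff_exists_nnreal_btwn.1 hT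
  have hr0 : 0 < r := by
    have := pos_of_gt hr
    exact_mod_cast this
  obtain ⟨m, hm, hm1⟩ := (((spectrum.pow_nnnorm_pow_one_div_tendsto_nhds_spectralRadius
    T).eventually_lt_const hr).and (eventually_ge_atTop 1)).exists
  have hpow : ‖T ^ m‖ ≤ (r : ℝ) ^ m := by
    have hm0 : (0 : ℝ) < m := by exact_mod_cast hm1
    have h := hm.le
    rw [one_div, ENNReal.rpow_inv_le_iff hm0, ENNReal.rpow_natCast] at h
    exact_mod_cast h
  let f : E → ℕ → ℝ := fun v k => (r : ℝ)⁻¹ ^ k * ‖(T ^ k) v‖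
  have hr0' : (0 : ℝ) < r := hr0
  let N : Seminorm ℂ E := Seminorm.of (fun v => ∑ k ∈ Finset.range m, f v k)
    (fun x y => by
      rw [← Finset.sum_add_distrib]
      refine Finset.sum_le_sum fun k _ => ?_
      simp only [f, map_add, ← mul_add]
      gcongr
      exact norm_add_le _ _)
    (fun a x => by
      rw [Finset.mul_sum]
      refine Finset.sum_congr rfl fun k _ => ?_
      simp only [f, map_smul, norm_smul]
      ring)
  have hN : ∀ v, N v = ∑ k ∈ Finset.range m, f v k := fun _ => rfl
  have hf0 : ∀ v k, 0 ≤ f v k := fun v k => by positivity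
  refine ⟨N, ∑ k ∈ Finset.range m, (r : ℝ)⁻¹ ^ k * ‖T ^ k‖, r, by positivity,
    by exact_mod_cast hr1, fun v => ?_, fun v => ?_, fun v => ?_⟩
  · rw [hN]
    calc ‖v‖ = f v 0 := by simp [f]
      _ ≤ _ := Finset.single_le_sum (fun k _ => hf0 v k) (Finset.mem_range.2 hm1)
  · rw [hN, Finset.sum_mul]
    refine Finset.sum_le_sum fun k _ => ?_
    rw [mul_assoc]
    exact mul_le_mul_of_nonneg_left ((T ^ k).le_opNorm v) (by positivity)
  · have hshift : ∀ k, f (T v) k = r * f v (k + 1) := fun k => by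
      simp only [f, pow_succ, mul_apply_eq_comp]
      field_simp
    rw [hN, hN, Finset.sum_congr rfl fun k _ => hshift k, ← Finset.mul_sum]
    refine mul_le_mul_of_nonneg_left ?_ hr0'.le
    have htel := (Finset.sum_range_succ (f v) m).symm.trans (Finset.sum_range_succ' (f v) m)
    have hlast : f v m ≤ f v 0 := by
      calc f v m ≤ (r : ℝ)⁻¹ ^ m * ((r : ℝ) ^ m * ‖v‖) := by
            refine mul_le_mul_of_nonneg_left ?_ (by positivity)
            exact ((T ^ m).le_opNorm v).trans (by gcongr)
        _ = f v 0 := by simp [f, hr0'.ne']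
    linarith

/-- For `γ ≤ ε`, the step `1 - γ M` is a convex combination of `1` and of `1 - ε M`, and
the latter is a strict contraction in a suitable norm once its spectral radius is below one. -/
theorem exists_seminorm_sub_smul_le [CompleteSpace E] (M : E →L[ℂ] E)
    (hM : ∀ z ∈ spectrum ℂ M, 0 < z.re) :
    ∃ (N : Seminorm ℂ E) (C c ε : ℝ), 0 ≤ C ∧ 0 < c ∧ 0 < ε ∧ (∀ v, ‖v‖ ≤ N v) ∧
      (∀ v, N v ≤ C * ‖v‖) ∧
      ∀ γ : ℝ, 0 ≤ γ → γ ≤ ε → ∀ v, N (v - (γ : ℂ) • M v) ≤ (1 - c * γ) * N v := by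
  obtain ⟨ε, hε, hrad⟩ := exists_spectralRadius_one_sub_smul_lt_one M hM
  obtain ⟨N, C, ρ, hC, hρ, hN1, hN2, hN3⟩ :=
    exists_seminorm_le_mul_of_spectralRadius_lt_one _ hrad
  refine ⟨N, C, (1 - ρ) / ε, ε, hC, div_pos (by linarith) hε, hε, hN1, hN2, ?_⟩
  intro γ h0 h1 v
  set t : ℝ := γ / ε with ht
  have ht0 : 0 ≤ t := by positivity
  have ht1 : t ≤ 1 := (div_le_one hε).2 h1
  have hcomb : v - (γ : ℂ) • M v
      = ((1 - t : ℝ) : ℂ) • v + (t : ℂ) • (1 - (ε : ℂ) • M) v := by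
    have hγ : (γ : ℂ) = t * ε := by
      rw [← Complex.ofReal_mul, ht, div_mul_cancel₀ _ hε.ne']
    simp only [sub_apply, one_apply_eq_self, smul_apply, hγ, Complex.ofReal_sub,
      Complex.ofReal_one]
    module
  calc N (v - (γ : ℂ) • M v)
      ≤ (1 - t) * N v + t * N ((1 - (ε : ℂ) • M) v) := by
        rw [hcomb]
        refine (map_add_le_add N _ _).trans (le_of_eq ?_)
        rw [map_smul_eq_mul, map_smul_eq_mul, Complex.norm_real, Complex.norm_real,
          Real.norm_of_nonneg ht0, Real.norm_of_nonneg (sub_nonneg.2 ht1)]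
    _ ≤ (1 - t) * N v + t * (ρ * N v) := by
        gcongr
        exact hN3 v
    _ = (1 - (1 - ρ) / ε * γ) * N v := by
        rw [ht]
        ring

/-! ### The linear two-timescale recursion -/

/-- In the coordinates `v = u + L q`, `q`, with `v` the deviation of `u` from the equilibrium that
`q` induces, `v` contracts at rate `γ`, `q` contracts at rate `β`, and the coupling terms are of
order `β`. -/
theorem tendsto_zero_of_linear_two_timescale [CompleteSpace E] {M L : E →L[ℂ] E}
    (hML : ∀ v, M (L v) = v)
    (hM : ∀ z ∈ spectrum ℂ M, 0 < z.re) (hL : ∀ z ∈ spectrum ℂ L, 0 < z.re) {γ β : ℕ → ℝ}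
    (hγ : ∀ k, 0 < γ k) (hβ : ∀ k, 0 < β k) (hγ0 : Tendsto γ atTop (𝓝 0))
    (hβ0 : Tendsto β atTop (𝓝 0))
    (hsum : Tendsto (fun n => ∑ k ∈ Finset.range n, β k) atTop atTop)
    (hratio : Tendsto (fun k => β k / γ k) atTop (𝓝 0)) {u q : ℕ → E}
    (hu : ∀ k, u (k + 1) = u k - (γ k : ℂ) • (M (u k) + q k))
    (hq : ∀ k, q (k + 1) = q k + (β k : ℂ) • (u k - M (u k) - q k)) :
    Tendsto u atTop (𝓝 0) ∧ Tendsto q atTop (𝓝 0) := by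
  obtain ⟨N, C, c, ε, hC, hc, hε, hN1, hN2, hN3⟩ := exists_seminorm_sub_smul_le M hM
  obtain ⟨N', C', d, ε', hC', hd, hε', hN1', hN2', hN3'⟩ := exists_seminorm_sub_smul_le L hL
  set v : ℕ → E := fun k => u k + L (q k) with hv
  have hMu : ∀ k, M (u k) = M (v k) - q k := fun k => by simp [hv, hML]
  have hq' : ∀ k, q (k + 1) = (q k - (β k : ℂ) • L (q k)) + (β k : ℂ) • (1 - M) (v k) := fun k => by
    rw [hq, hMu]
    simp only [hv, sub_apply, one_apply_eq_self]
    module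
  have hv' : ∀ k, v (k + 1) = (v k - (γ k : ℂ) • M (v k))
      + (β k : ℂ) • ((L * (1 - M)) (v k) - (L * L) (q k)) := fun k => by
    have h1 : v (k + 1) = u (k + 1) + L (q (k + 1)) := rfl
    rw [h1, hu, hq', hMu]
    simp only [hv, mul_apply_eq_comp, sub_apply, one_apply_eq_self, map_add, map_sub, map_smul]
    module
  have hnorm : ∀ {r : ℝ}, 0 < r → ‖(r : ℂ)‖ = r := fun hr => by
    rw [Complex.norm_real, Real.norm_of_nonneg hr.le]
  have hlim := tendsto_zero_of_two_timescale (a := fun k => N (v k)) (b := fun k => N' (q k))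
    (A := C * ‖L * (1 - M)‖) (B := C * ‖L * L‖) (D := C' * ‖1 - M‖) hc hd (by positivity)
    (fun k => apply_nonneg N _) (fun k => apply_nonneg N' _) hγ hβ hsum hratio ?_ ?_
  · have hv0 : Tendsto v atTop (𝓝 0) := squeeze_zero_norm (fun k => hN1 _) hlim.1
    have hq0 : Tendsto q atTop (𝓝 0) := squeeze_zero_norm (fun k => hN1' _) hlim.2
    refine ⟨?_, hq0⟩
    have h := hv0.sub ((L.continuous.tendsto 0).comp hq0)
    simpa [hv, Function.comp_def] using h
  · filter_upwards [hγ0.eventually_le_const hε] with k hk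
    have h1 : N ((L * (1 - M)) (v k) - (L * L) (q k))
        ≤ C * ‖L * (1 - M)‖ * N (v k) + C * ‖L * L‖ * N' (q k) := by
      calc N ((L * (1 - M)) (v k) - (L * L) (q k))
          ≤ C * ‖(L * (1 - M)) (v k) - (L * L) (q k)‖ := hN2 _
        _ ≤ C * (‖L * (1 - M)‖ * N (v k) + ‖L * L‖ * N' (q k)) := by
            gcongr
            exact (norm_sub_le _ _).trans (add_le_add
              (ContinuousLinearMap.le_opNorm_of_le _ (hN1 _))
              (ContinuousLinearMap.le_opNorm_of_le _ (hN1' _)))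
        _ = _ := by ring
    rw [hv']
    refine (map_add_le_add N _ _).trans (add_le_add (hN3 _ (hγ k).le hk _) ?_)
    rw [map_smul_eq_mul, hnorm (hβ k)]
    exact mul_le_mul_of_nonneg_left h1 (hβ k).le
  · filter_upwards [hβ0.eventually_le_const hε'] with k hk
    rw [hq']
    refine (map_add_le_add N' _ _).trans (add_le_add (hN3' _ (hβ k).le hk _) ?_)
    rw [map_smul_eq_mul, hnorm (hβ k), mul_assoc]
    refine mul_le_mul_of_nonneg_left ((hN2' _).trans ?_) (hβ k).le
    exact mul_le_mul_of_nonneg_left (ContinuousLinearMap.le_opNorm_of_le _ (hN1 _)) hC'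

end

namespace QuadGame

/-! ### First-order conditions of the game -/

lemma forall_quadratic_le_iff (b s : ℝ) :
    (∀ t : ℝ, (1 / 2) * s ^ 2 - b * s ≤ (1 / 2) * t ^ 2 - b * t) ↔ s = b := by
  constructor
  · intro h
    have hb := h b
    nlinarith [sq_nonneg (s - b)]
  · rintro rfl t
    nlinarith [sq_nonneg (t - s)]

theorem isSociallyOptimal_iff {ι : Type*} [Fintype ι] {ξ x : ι → ℝ} :
    IsSociallyOptimal ξ x ↔ x = -ξ := by
  have h0 : socialCost ξ (-ξ) = 0 := by simp [socialCost]
  constructor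
  · intro h
    have hle := h (-ξ)
    have hsum : ∑ i, (x i + ξ i) ^ 2 ≤ 0 := by
      rw [h0, socialCost] at hle
      linarith
    have hall := (Finset.sum_eq_zero_iff_of_nonneg fun i _ => sq_nonneg (x i + ξ i)).1
      (hsum.antisymm (Finset.sum_nonneg fun i _ => sq_nonneg _))
    ext i
    have := pow_eq_zero_iff two_ne_zero |>.1 (hall i (Finset.mem_univ i))
    rw [Pi.neg_apply]
    linarith
  · rintro rfl y
    rw [h0]
    exact mul_nonneg (by norm_num) (Finset.sum_nonneg fun i _ => sq_nonneg _)

variable {ι : Type*} [Fintype ι] [DecidableEq ι] {κ ξ : ι → ℝ} {Z : Matrix ι ι ℝ}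

lemma aggregate_update {i : ι} (hZ : Z i i = 0) (x : ι → ℝ) (t : ℝ) :
    aggregate Z i (Function.update x i t) = aggregate Z i x := by
  refine Finset.sum_congr rfl fun j _ => ?_
  rcases eq_or_ne j i with rfl | h
  · simp [hZ]
  · simp [h]

lemma loss_update {i : ι} (hZ : Z i i = 0) (x : ι → ℝ) (t : ℝ) :
    loss κ Z i (Function.update x i t) = (1 / 2) * t ^ 2 - κ i * t * aggregate Z i x := by
  simp [loss, aggregate_update hZ]

lemma totalCost_update {i : ι} (hZ : Z i i = 0) (p x : ι → ℝ) (t : ℝ) :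
    totalCost κ Z p i (Function.update x i t)
      = (1 / 2) * t ^ 2 - (κ i * aggregate Z i x - p i) * t := by
  rw [totalCost, loss_update hZ, Function.update_self]
  ring

lemma diagonal_mul_mulVec_apply (κ : ι → ℝ) (Z : Matrix ι ι ℝ) (x : ι → ℝ) (i : ι) :
    (Matrix.diagonal κ * Z).mulVec x i = κ i * aggregate Z i x := by
  rw [← Matrix.mulVec_mulVec, Matrix.mulVec_diagonal]
  rfl

lemma networkMatrix_mulVec (κ : ι → ℝ) (Z : Matrix ι ι ℝ) (x : ι → ℝ) :
    (networkMatrix κ Z).mulVec x = x - (Matrix.diagonal κ * Z).mulVec x := by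
  rw [networkMatrix, Matrix.sub_mulVec, Matrix.one_mulVec]

theorem isBestResponse_iff (hZ : ∀ i, Z i i = 0) {x p y : ι → ℝ} :
    IsBestResponse κ Z x p y ↔ y = (Matrix.diagonal κ * Z).mulVec x - p := by
  rw [funext_iff]
  refine forall_congr' fun i => ?_
  simp only [totalCost_update (hZ i), Pi.sub_apply, diagonal_mul_mulVec_apply]
  exact forall_quadratic_le_iff _ _

lemma isNash_iff_isBestResponse {x p : ι → ℝ} :
    IsNash κ Z p x ↔ IsBestResponse κ Z x p x := by
  simp [IsNash, IsBestResponse]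

lemma isNash_iff_mulVec (hZ : ∀ i, Z i i = 0) {x p : ι → ℝ} :
    IsNash κ Z p x ↔ (networkMatrix κ Z).mulVec x = -p := by
  rw [isNash_iff_isBestResponse, isBestResponse_iff hZ, networkMatrix_mulVec, sub_eq_iff_eq_add,
    neg_add_eq_sub]

theorem isNash_iff (hZ : ∀ i, Z i i = 0) (hinv : IsUnit (networkMatrix κ Z)) {x p : ι → ℝ} :
    IsNash κ Z p x ↔ x = -(networkMatrix κ Z)⁻¹.mulVec p := by
  have hdet := (Matrix.isUnit_iff_isUnit_det _).1 hinv
  rw [isNash_iff_mulVec hZ, ← Matrix.mulVec_neg]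
  constructor
  · intro h
    rw [← h, Matrix.mulVec_mulVec, Matrix.nonsing_inv_mul _ hdet, Matrix.one_mulVec]
  · rintro rfl
    rw [Matrix.mulVec_mulVec, Matrix.mul_nonsing_inv _ hdet, Matrix.one_mulVec]

lemma partialDeriv_loss {i : ι} (hZ : Z i i = 0) (x : ι → ℝ) :
    partialDeriv i (loss κ Z i) x = x i - κ i * aggregate Z i x := by
  simp only [partialDeriv, loss_update hZ]
  have h := (((hasDerivAt_id (x i)).pow 2).const_mul (1 / 2 : ℝ)).sub
    (((hasDerivAt_id (x i)).const_mul (κ i)).mul_const (aggregate Z i x))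
  refine (HasDerivAt.deriv (f := fun t : ℝ => (1 / 2) * t ^ 2 - κ i * t * aggregate Z i x)
    h).trans ?_
  simp

lemma partialDeriv_socialCost (i : ι) (x : ι → ℝ) :
    partialDeriv i (socialCost ξ) x = x i + ξ i := by
  have hsplit : ∀ t : ℝ, socialCost ξ (Function.update x i t)
      = (1 / 2) * (t + ξ i) ^ 2 + (1 / 2) * ∑ j ∈ Finset.univ.erase i, (x j + ξ j) ^ 2 := by
    intro t
    rw [socialCost, ← Finset.add_sum_erase _ _ (Finset.mem_univ i), Function.update_self, mul_add]
    congr 2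
    refine Finset.sum_congr rfl fun j hj => ?_
    rw [Function.update_of_ne (Finset.ne_of_mem_erase hj)]
  simp only [partialDeriv, hsplit]
  have h := ((((hasDerivAt_id (x i)).add_const (ξ i)).pow 2).const_mul (1 / 2 : ℝ)).add_const
    ((1 / 2) * ∑ j ∈ Finset.univ.erase i, (x j + ξ j) ^ 2)
  refine (HasDerivAt.deriv (f := fun t : ℝ => (1 / 2) * (t + ξ i) ^ 2 + (1 / 2) *
    ∑ j ∈ Finset.univ.erase i, (x j + ξ j) ^ 2) h).trans ?_
  simp

theorem externality_eq (hZ : ∀ i, Z i i = 0) (x : ι → ℝ) :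
    externality κ Z ξ x = ξ + (Matrix.diagonal κ * Z).mulVec x := by
  ext i
  rw [externality, partialDeriv_socialCost, partialDeriv_loss (hZ i), Pi.add_apply,
    diagonal_mul_mulVec_apply]
  ring

/-! ### Optimal incentives -/

theorem isSociallyOptimalIncentive_iff (hZ : ∀ i, Z i i = 0) (hinv : IsUnit (networkMatrix κ Z))
    {p : ι → ℝ} :
    IsSociallyOptimalIncentive κ Z ξ p ↔ p = (networkMatrix κ Z).mulVec ξ := by
  constructor
  · rintro ⟨⟨x, hx⟩, hopt⟩
    have h := isSociallyOptimal_iff.1 (hopt x hx)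
    rw [isNash_iff_mulVec hZ, h, Matrix.mulVec_neg, neg_inj] at hx
    exact hx.symm
  · rintro rfl
    refine ⟨⟨_, (isNash_iff hZ hinv).2 rfl⟩, fun x hx => isSociallyOptimal_iff.2 ?_⟩
    rw [isNash_iff hZ hinv, Matrix.mulVec_mulVec,
      Matrix.nonsing_inv_mul _ ((Matrix.isUnit_iff_isUnit_det _).1 hinv), Matrix.one_mulVec] at hx
    exact hx

/-- At an equilibrium `K Z x = x + p`, so the externality equals `p` exactly when `x = -ξ`. -/
theorem exists_isNash_externality_eq_iff (hZ : ∀ i, Z i i = 0) {p : ι → ℝ} :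
    (∃ x, IsNash κ Z p x ∧ externality κ Z ξ x = p) ↔ p = (networkMatrix κ Z).mulVec ξ := by
  constructor
  · rintro ⟨x, hx, he⟩
    rw [externality_eq hZ] at he
    rw [isNash_iff_mulVec hZ] at hx
    have hxξ : x = -ξ := by
      rw [networkMatrix_mulVec] at hx
      linear_combination (exp := 1) hx + he
    rw [hxξ, Matrix.mulVec_neg, neg_inj] at hx
    exact hx.symm
  · rintro rfl
    refine ⟨-ξ, (isNash_iff_mulVec hZ).2 (Matrix.mulVec_neg _ _), ?_⟩
    rw [externality_eq hZ, networkMatrix_mulVec, Matrix.mulVec_neg, sub_eq_add_neg]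

/-! ### Spectra -/

lemma mem_spec_nonsing_inv {A : Matrix ι ι ℝ} (hA : IsUnit A) {z : ℂ} :
    z ∈ spec A⁻¹ ↔ z⁻¹ ∈ spec A := by
  obtain ⟨U, rfl⟩ := hA
  have h := spectrum.map_inv (𝕜 := ℂ)
    (Units.map (Complex.ofRealHom.mapMatrix (m := ι)).toMonoidHom U)
  rw [← Matrix.coe_units_inv]
  change z ∈ spectrum ℂ _ ↔ z⁻¹ ∈ spectrum ℂ _
  rw [← Set.mem_inv, ← map_inv] at *
  exact (Set.ext_iff.1 h z).symm

theorem forall_spec_re_pos_iff {A : Matrix ι ι ℝ} (hA : IsUnit A) :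
    (∀ z ∈ spec A, 0 < z.re) ↔ ∀ z ∈ spec A⁻¹, 0 < z.re := by
  have hre : ∀ z : ℂ, 0 < z⁻¹.re → 0 < z.re := fun z hz => by
    rw [Complex.inv_re] at hz
    by_contra! h
    exact absurd hz (not_lt.2 (div_nonpos_of_nonpos_of_nonneg h (Complex.normSq_nonneg z)))
  constructor
  · exact fun h z hz => hre z (h _ ((mem_spec_nonsing_inv hA).1 hz))
  · exact fun h z hz => hre z (h _ ((mem_spec_nonsing_inv hA).2 (by rwa [inv_inv])))

/-- The action of a real matrix on complex vectors; its spectrum is the set `spec` of complex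
eigenvalues. -/
noncomputable def complexCLM (A : Matrix ι ι ℝ) : (ι → ℂ) →L[ℂ] (ι → ℂ) :=
  Module.End.toContinuousLinearMap (ι → ℂ) (Matrix.toLinAlgEquiv' (A.map Complex.ofReal))

lemma spectrum_complexCLM (A : Matrix ι ι ℝ) : spectrum ℂ (complexCLM A) = spec A := by
  rw [complexCLM, AlgEquiv.spectrum_eq, AlgEquiv.spectrum_eq, spec]

lemma complexCLM_mul (A B : Matrix ι ι ℝ) : complexCLM (A * B) = complexCLM A * complexCLM B := by
  have h : (A * B).map Complex.ofReal = A.map Complex.ofReal * B.map Complex.ofReal :=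
    Matrix.map_mul (f := Complex.ofRealHom)
  simp only [complexCLM, h, map_mul]

lemma complexCLM_one : complexCLM (1 : Matrix ι ι ℝ) = 1 := by
  simp [complexCLM]

lemma complexCLM_ofReal (A : Matrix ι ι ℝ) (x : ι → ℝ) :
    complexCLM A (fun i => (x i : ℂ)) = fun i => ((A.mulVec x i : ℝ) : ℂ) := by
  ext i
  change (A.map Complex.ofReal).mulVec (fun i => (x i : ℂ)) i = _
  simp [Matrix.mulVec, dotProduct]

/-! ### Convergence of the learning dynamics -/

lemma tendsto_zero_of_tendsto_ofReal {ι : Type*} {y : ℕ → ι → ℝ}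
    (h : Tendsto (fun k i => (y k i : ℂ)) atTop (𝓝 0)) : Tendsto y atTop (𝓝 0) := by
  rw [tendsto_pi_nhds] at h ⊢
  exact fun i => by simpa [Function.comp_def] using (Complex.continuous_re.tendsto _).comp (h i)

lemma tendsto_zero_of_summable_sq {f : ℕ → ℝ} (h : Summable fun k => f k ^ 2) :
    Tendsto f atTop (𝓝 0) := by
  rw [tendsto_zero_iff_abs_tendsto_zero]
  simpa [Function.comp_def, Real.sqrt_sq_eq_abs] using
    (Real.continuous_sqrt.tendsto 0).comp h.tendsto_atTop_zero

lemma IsStepSizes.tendsto_x {γ β : ℕ → ℝ} (h : IsStepSizes γ β) : Tendsto γ atTop (𝓝 0) :=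
  tendsto_zero_of_summable_sq <| h.sq_summable.of_nonneg_of_le (fun _ => sq_nonneg _)
    fun _ => le_add_of_nonneg_right (sq_nonneg _)

lemma IsStepSizes.tendsto_p {γ β : ℕ → ℝ} (h : IsStepSizes γ β) : Tendsto β atTop (𝓝 0) :=
  tendsto_zero_of_summable_sq <| h.sq_summable.of_nonneg_of_le (fun _ => sq_nonneg _)
    fun _ => le_add_of_nonneg_left (sq_nonneg _)

theorem IsLearningDynamics.tendsto (hZ : ∀ i, Z i i = 0) (hinv : IsUnit (networkMatrix κ Z))
    (hspec : ∀ z ∈ spec (networkMatrix κ Z), 0 < z.re) {γ β : ℕ → ℝ} (hstep : IsStepSizes γ β)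
    {x p : ℕ → ι → ℝ} (hdyn : IsLearningDynamics κ Z ξ γ β x p) :
    Tendsto (fun k => (x k, p k)) atTop (𝓝 (-ξ, (networkMatrix κ Z).mulVec ξ)) := by
  set M := networkMatrix κ Z with hM
  have hKZ : ∀ y, (Matrix.diagonal κ * Z).mulVec y = y - M.mulVec y := fun y => by
    rw [hM, networkMatrix_mulVec, sub_sub_cancel]
  -- `u = x + ξ` and `q = p - M ξ` satisfy the linear recursion without inhomogeneous terms
  have hu : ∀ k, x (k + 1) + ξ
      = (x k + ξ) - γ k • (M.mulVec (x k + ξ) + (p k - M.mulVec ξ)) := fun k => by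
    obtain ⟨y, hy, hx⟩ := (hdyn k).1
    rw [isBestResponse_iff hZ, hKZ] at hy
    rw [hx, hy, Matrix.mulVec_add]
    module
  have hq : ∀ k, p (k + 1) - M.mulVec ξ = (p k - M.mulVec ξ)
      + β k • ((x k + ξ) - M.mulVec (x k + ξ) - (p k - M.mulVec ξ)) := fun k => by
    rw [(hdyn k).2, externality_eq hZ, hKZ, Matrix.mulVec_add]
    module
  have hlim := tendsto_zero_of_linear_two_timescale (M := complexCLM M) (L := complexCLM M⁻¹)
    (γ := γ) (β := β) (u := fun k i => ((x k + ξ) i : ℂ))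
    (q := fun k i => ((p k - M.mulVec ξ) i : ℂ)) ?_ ?_ ?_ (fun k => (hstep.mem_x k).1)
    (fun k => (hstep.mem_p k).1) hstep.tendsto_x hstep.tendsto_p hstep.sum_p hstep.ratio ?_ ?_
  · have hx := (tendsto_zero_of_tendsto_ofReal hlim.1).sub_const ξ
    have hp := (tendsto_zero_of_tendsto_ofReal hlim.2).add_const (M.mulVec ξ)
    simp only [add_sub_cancel_right, sub_add_cancel, zero_sub, zero_add] at hx hp
    exact hx.prodMk_nhds hp
  · intro v
    rw [← mul_apply_eq_comp, ← complexCLM_mul,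
      Matrix.mul_nonsing_inv _ ((Matrix.isUnit_iff_isUnit_det _).1 hinv), complexCLM_one,
      one_apply_eq_self]
  · rwa [spectrum_complexCLM]
  · rw [spectrum_complexCLM]
    exact (forall_spec_re_pos_iff hinv).1 hspec
  · intro k
    simp only [hu k, complexCLM_ofReal]
    ext i
    simp
  · intro k
    simp only [hq k, complexCLM_ofReal]
    ext i
    simp

end QuadGame

theorem proposition3 {ι : Type*} [Fintype ι] [DecidableEq ι]
    (κ : ι → ℝ) (Z : Matrix ι ι ℝ) (ξ : ι → ℝ)
    (hκ : ∀ i, 0 < κ i) (hZ : ∀ i, Z i i = 0) (hinv : IsUnit (QuadGame.networkMatrix κ Z)) :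
    -- the planner's optimal profile is unique
    (∀ x : ι → ℝ, QuadGame.IsSociallyOptimal ξ x ↔ x = -ξ) ∧
    -- each incentive vector has exactly one equilibrium
    (∀ p x : ι → ℝ, QuadGame.IsNash κ Z p x ↔
      x = -Matrix.mulVec (QuadGame.networkMatrix κ Z)⁻¹ p) ∧
    -- the unique socially optimal incentive
    (∀ p : ι → ℝ, QuadGame.IsSociallyOptimalIncentive κ Z ξ p ↔
      p = Matrix.mulVec (QuadGame.networkMatrix κ Z) ξ) ∧
    -- it is also the unique incentive that equals the externality at its equilibrium
    (∀ p : ι → ℝ, (∃ x, QuadGame.IsNash κ Z p x ∧ QuadGame.externality κ Z ξ x = p) ↔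
      p = Matrix.mulVec (QuadGame.networkMatrix κ Z) ξ) ∧
    -- the two forms of the spectral condition agree
    ((∀ z ∈ QuadGame.spec (QuadGame.networkMatrix κ Z), 0 < z.re) ↔
      ∀ z ∈ QuadGame.spec (QuadGame.networkMatrix κ Z)⁻¹, 0 < z.re) ∧
    -- the spectral condition implies convergence
    ((∀ z ∈ QuadGame.spec (QuadGame.networkMatrix κ Z), 0 < z.re) →
      ∀ γ β : ℕ → ℝ, QuadGame.IsStepSizes γ β →
      ∀ x p : ℕ → ι → ℝ, QuadGame.IsLearningDynamics κ Z ξ γ β x p →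
        Tendsto (fun k => (x k, p k)) atTop
          (𝓝 (-ξ, Matrix.mulVec (QuadGame.networkMatrix κ Z) ξ))) := by
  exact ⟨fun x => QuadGame.isSociallyOptimal_iff, fun p x => QuadGame.isNash_iff hZ hinv,
    fun p => QuadGame.isSociallyOptimalIncentive_iff hZ hinv,
    fun p => QuadGame.exists_isNash_externality_eq_iff hZ, QuadGame.forall_spec_re_pos_iff hinv,
    fun hspec γ β hstep x p hdyn => hdyn.tendsto hZ hinv hspec hstep⟩
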